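/- **Non-Garbage Critical Pair Lemma.** Let $\mathcal L=(\mathcal L_V,\mathcal L_E)$ be a pair of finite sets of node and edge labels. A *graph* is a finite directed graph (loops and parallel edges allowed) all of whose nodes and edges are labelled, with labels in $\mathcal L_V$ and $\mathcal L_E$ respectively; *morphisms* preserve sources, targets and labels. Write $[G]$ for the isomorphism class of $G$ and $\mathcal G(\mathcal L)$ for the set of all such classes. A *rule* $r=\langle L\leftarrow K\to R\rangle$ consists of graphs $L,K,R$ and inclusions $K\hookrightarrow L$, $K\hookrightarrow R$. A *match* of $r$ in $G$ is an injective morphism $g:L\to G$ such that no edge of $G$ outside $g(L)$ is incident to a node in $g(L\setminus K)$. A *direct derivation* $G\Rightarrow_{r,g}H$ deletes $g(L\setminus K)$ from $G$ and then adds $R\setminus K$ disjointly, glued along $K$; $H$ is determined up to isomorphism. Its *track* is the partial function from the nodes of $G$ to the nodes of $H$ that is defined on the nodes which are not deleted and sends each of them to the corresponding node of $H$. A *graph transformation system* $T=(\mathcal L,\mathcal R)$ has a finite set $\mathcal R$ of such rules. Write $G\Rightarrow_{\mathcal R}H$ if $G\Rightarrow_{r,g}H$ for some $r\in\mathcal R$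 and some match $g$, and $G\Rightarrow^*_{\mathcal R}H$ if $G\cong H$ or $H$ arises from $G$ by finitely many direct derivations; tracks compose along derivations, the track of a derivation without steps being the isomorphism. Graphs $H_1,H_2$ are *joinable* if $H_1\Rightarrow^*_{\mathcal R}M$ and $H_2\Rightarrow^*_{\mathcal R}M$ for some graph $M$. A pair of direct derivations $\Phi: H_1\Leftarrow_{r_1,g_1}G\Rightarrow_{r_2,g_2}H_2$ with $r_1,r_2\in\mathcal R$ is a *critical pair* if (i) $G=g_1(L_1)\cup g_2(L_2)$; (ii) the steps are not parallelly independent, i.e. $g_1(L_1)\cap g_2(L_2)\not\subseteq g_1(K_1)\cap g_2(K_2)$ (for nodes or for edges); and (iii) if $r_1=r_2$ then $g_1\ne g_2$. It is *strongly joinable* if there are a graph $M$ and derivations $H_1\Rightarrow^*_{\mathcal R}M$, $H_2\Rightarrow^*_{\mathcal R}M$ such that, for every node $v$ of $G$ deleted by neither step of $\Phi$, the tracks of $v$ along $G\Rightarrow H_1\Rightarrow^*M$ and along $G\Rightarrow H_2\Rightarrow^*M$ are both defined and are equal. Let $D\subseteq\mathcal G(\mathcal L)$. Its *subgraph closure*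 $\overline D$ is the smallest set containing $D$ such that $[G]\in\overline D$ and $H\subseteq G$ imply $[H]\in\overline D$. A critical pair with start graph $G$ is *non-garbage* (with respect to $D$) if $[G]\in\overline D$. **Theorem.** Let $T=(\mathcal L,\mathcal R)$ be a graph transformation system and $D\subseteq\mathcal G(\mathcal L)$. If all non-garbage critical pairs of $T$ are strongly joinable, then $T$ is locally confluent on $D$: for all graphs $G,H_1,H_2$ with $[G]\in D$, $G\Rightarrow_{\mathcal R}H_1$ and $G\Rightarrow_{\mathcal R}H_2$, the graphs $H_1$ and $H_2$ are joinable. -/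

import Mathlib

namespace GraphTransformation

/-- A label alphabet: finite sets of node labels and of edge labels. -/
structure LabelAlphabet where
  NodeLabel : Type*
  EdgeLabel : Type*
  finite_nodeLabel : Finite NodeLabel
  finite_edgeLabel : Finite EdgeLabel

/-- A concrete, totally labelled graph over `A`: finitely many nodes and edges, source and
target functions (so loops and parallel edges are allowed), and total label functions. -/
structure Graph (A : LabelAlphabet) where
  V : Type
  E : Type
  finite_V : Finite V
  finite_E : Finite E
  source : E → V
  target : E → V
  nodeLabel : V → A.NodeLabel
  edgeLabel : E → A.EdgeLabel

variable {A : LabelAlphabet}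

/-- Graph morphisms: they preserve sources, targets and labels. -/
structure Hom (G H : Graph A) where
  onV : G.V → H.V
  onE : G.E → H.E
  source_onE : ∀ e, H.source (onE e) = onV (G.source e)
  target_onE : ∀ e, H.target (onE e) = onV (G.target e)
  nodeLabel_onV : ∀ v, H.nodeLabel (onV v) = G.nodeLabel v
  edgeLabel_onE : ∀ e, H.edgeLabel (onE e) = G.edgeLabel e

/-- A morphism is injective if both of its components are. -/
def Hom.Injective {G H : Graph A} (f : Hom G H) : Prop :=
  Function.Injective f.onV ∧ Function.Injective f.onE

/-- Graph isomorphisms. -/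
structure Iso (G H : Graph A) where
  onV : G.V ≃ H.V
  onE : G.E ≃ H.E
  source_onE : ∀ e, H.source (onE e) = onV (G.source e)
  target_onE : ∀ e, H.target (onE e) = onV (G.target e)
  nodeLabel_onV : ∀ v, H.nodeLabel (onV v) = G.nodeLabel v
  edgeLabel_onE : ∀ e, H.edgeLabel (onE e) = G.edgeLabel e

/-- The identity isomorphism. -/
def Iso.refl (G : Graph A) : Iso G G where
  onV := Equiv.refl _
  onE := Equiv.refl _
  source_onE _ := rfl
  target_onE _ := rfl
  nodeLabel_onV _ := rfl
  edgeLabel_onE _ := rfl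

/-- The inverse isomorphism. -/
def Iso.symm {G H : Graph A} (f : Iso G H) : Iso H G where
  onV := f.onV.symm
  onE := f.onE.symm
  source_onE e := by rw [Equiv.eq_symm_apply, ← f.source_onE, Equiv.apply_symm_apply]
  target_onE e := by rw [Equiv.eq_symm_apply, ← f.target_onE, Equiv.apply_symm_apply]
  nodeLabel_onV v := by rw [← f.nodeLabel_onV, Equiv.apply_symm_apply]
  edgeLabel_onE e := by rw [← f.edgeLabel_onE, Equiv.apply_symm_apply]

/-- Composition of isomorphisms. -/
def Iso.trans {G H M : Graph A} (f : Iso G H) (g : Iso H M) : Iso G M where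
  onV := f.onV.trans g.onV
  onE := f.onE.trans g.onE
  source_onE e := by simp [g.source_onE, f.source_onE]
  target_onE e := by simp [g.target_onE, f.target_onE]
  nodeLabel_onV v := by simp [g.nodeLabel_onV, f.nodeLabel_onV]
  edgeLabel_onE e := by simp [g.edgeLabel_onE, f.edgeLabel_onE]

/-- The relation of being isomorphic. -/
instance isoSetoid (A : LabelAlphabet) : Setoid (Graph A) where
  r G H := Nonempty (Iso G H)
  iseqv :=
    { refl := fun G => ⟨Iso.refl G⟩
      symm := fun ⟨f⟩ => ⟨f.symm⟩
      trans := fun ⟨f⟩ ⟨g⟩ => ⟨f.trans g⟩ }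

/-- Abstract graphs: isomorphism classes of totally labelled graphs. -/
def AbstractGraph (A : LabelAlphabet) : Type _ := Quotient (isoSetoid A)

/-- The abstract graph `[G]`. -/
def Graph.cls (G : Graph A) : AbstractGraph A := Quotient.mk (isoSetoid A) G

/-- A subgraph of `G`: a set of nodes and a set of edges containing all end points of its edges. -/
structure Subgraph (G : Graph A) where
  nodes : Set G.V
  edges : Set G.E
  source_mem : ∀ e ∈ edges, G.source e ∈ nodes
  target_mem : ∀ e ∈ edges, G.target e ∈ nodes

/-- A subgraph, seen as a graph with the restricted structure. -/
def Subgraph.toGraph {G : Graph A} (S : Subgraph G) : Graph A where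
  V := S.nodes
  E := S.edges
  finite_V := have := G.finite_V; inferInstance
  finite_E := have := G.finite_E; inferInstance
  source e := ⟨G.source e, S.source_mem e e.2⟩
  target e := ⟨G.target e, S.target_mem e e.2⟩
  nodeLabel v := G.nodeLabel v
  edgeLabel e := G.edgeLabel e

/-- A set of abstract graphs is subgraph closed if with `[G]` it contains `[H]` for every
subgraph `H` of `G`. -/
def SubgraphClosed (D : Set (AbstractGraph A)) : Prop :=
  ∀ (G : Graph A) (S : Subgraph G), G.cls ∈ D → S.toGraph.cls ∈ D

/-- The subgraph closure of `D`: the smallest subgraph closed set containing `D`. -/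
def subgraphClosure (D : Set (AbstractGraph A)) : Set (AbstractGraph A) :=
  ⋂₀ {D' | D ⊆ D' ∧ SubgraphClosed D'}

/-- A rule `⟨L ← K → R⟩` of totally labelled graphs, `K` being included in `L` and in `R`. -/
structure Rule (A : LabelAlphabet) where
  L : Graph A
  K : Graph A
  R : Graph A
  left : Hom K L
  right : Hom K R
  left_injective : left.Injective
  right_injective : right.Injective

/-- A graph transformation system over `A`: a finite set of rules. -/
structure GTSystem (A : LabelAlphabet) where
  rules : Set (Rule A)
  finite_rules : rules.Finite

/-- The nodes of `g(L \ K)`. -/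
def deletedNodes (r : Rule A) {G : Graph A} (g : Hom r.L G) : Set G.V :=
  g.onV '' (Set.range r.left.onV)ᶜ

/-- The edges of `g(L \ K)`. -/
def deletedEdges (r : Rule A) {G : Graph A} (g : Hom r.L G) : Set G.E :=
  g.onE '' (Set.range r.left.onE)ᶜ

/-- The dangling condition: no edge in `G \ g(L)` is incident to a node in `g(L \ K)`. -/
def Dangling (r : Rule A) {G : Graph A} (g : Hom r.L G) : Prop :=
  ∀ e, e ∉ Set.range g.onE → G.source e ∉ deletedNodes r g ∧ G.target e ∉ deletedNodes r g

/-- A match: an injective morphism from the left-hand side satisfying the dangling condition. -/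
structure Match (r : Rule A) (G : Graph A) where
  hom : Hom r.L G
  injective : hom.Injective
  dangling : Dangling r hom

theorem Match.left_notMem_deletedNodes {r : Rule A} {G : Graph A} (g : Match r G) (k : r.K.V) :
    g.hom.onV (r.left.onV k) ∉ deletedNodes r g.hom := by
  rintro ⟨x, hx, h⟩
  exact hx ⟨k, (g.injective.1 h).symm⟩

theorem Match.left_notMem_deletedEdges {r : Rule A} {G : Graph A} (g : Match r G) (k : r.K.E) :
    g.hom.onE (r.left.onE k) ∉ deletedEdges r g.hom := by
  rintro ⟨x, hx, h⟩
  exact hx ⟨k, (g.injective.2 h).symm⟩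

theorem Match.exists_left_of_notMem {r : Rule A} {G : Graph A} (g : Match r G) {e : G.E}
    (he : e ∉ deletedEdges r g.hom) (h : e ∈ Set.range g.hom.onE) :
    ∃ k, g.hom.onE (r.left.onE k) = e := by
  obtain ⟨x, rfl⟩ := h
  by_contra hk
  exact he ⟨x, fun ⟨k, hk'⟩ => hk ⟨k, by rw [hk']⟩, rfl⟩

/-- The intermediate graph of a rule application, as a subgraph of `G`: delete `g(L \ K)`. -/
def Match.intermediate {r : Rule A} {G : Graph A} (g : Match r G) : Subgraph G where
  nodes := (deletedNodes r g.hom)ᶜ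
  edges := (deletedEdges r g.hom)ᶜ
  source_mem e he := by
    by_cases h : e ∈ Set.range g.hom.onE
    · obtain ⟨k, rfl⟩ := g.exists_left_of_notMem he h
      rw [g.hom.source_onE, r.left.source_onE]
      exact g.left_notMem_deletedNodes _
    · exact (g.dangling e h).1
  target_mem e he := by
    by_cases h : e ∈ Set.range g.hom.onE
    · obtain ⟨k, rfl⟩ := g.exists_left_of_notMem he h
      rw [g.hom.target_onE, r.left.target_onE]
      exact g.left_notMem_deletedNodes _
    · exact (g.dangling e h).2

/-- The morphism from the interface of the rule to the intermediate graph. -/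
def Match.interface {r : Rule A} {G : Graph A} (g : Match r G) :
    Hom r.K g.intermediate.toGraph where
  onV k := ⟨g.hom.onV (r.left.onV k), g.left_notMem_deletedNodes k⟩
  onE k := ⟨g.hom.onE (r.left.onE k), g.left_notMem_deletedEdges k⟩
  source_onE e := Subtype.ext ((g.hom.source_onE _).trans (by rw [r.left.source_onE]))
  target_onE e := Subtype.ext ((g.hom.target_onE _).trans (by rw [r.left.target_onE]))
  nodeLabel_onV v := (g.hom.nodeLabel_onV _).trans (r.left.nodeLabel_onV v)
  edgeLabel_onE e := (g.hom.edgeLabel_onE _).trans (r.left.edgeLabel_onE e)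

open Classical in
/-- Where a node of `R` goes when `R \ K` is added disjointly to `D`, given `b : K → R` (injective)
and `d : K → D`: nodes `b k` of the interface become `d k`, the others are new. -/
noncomputable def glueNode {K R D : Graph A} (b : Hom K R) (d : Hom K D) (v : R.V) :
    D.V ⊕ {v : R.V // v ∉ Set.range b.onV} :=
  if h : v ∈ Set.range b.onV then Sum.inl (d.onV h.choose) else Sum.inr ⟨v, h⟩

/-- The gluing of `D` and `R` along `K`: add the items of `R \ K` disjointly to `D`. -/
noncomputable def glue {K R D : Graph A} (b : Hom K R) (d : Hom K D) : Graph A where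
  V := D.V ⊕ {v : R.V // v ∉ Set.range b.onV}
  E := D.E ⊕ {e : R.E // e ∉ Set.range b.onE}
  finite_V := have := D.finite_V; have := R.finite_V; inferInstance
  finite_E := have := D.finite_E; have := R.finite_E; inferInstance
  source := Sum.elim (fun e => Sum.inl (D.source e)) (fun e => glueNode b d (R.source e))
  target := Sum.elim (fun e => Sum.inl (D.target e)) (fun e => glueNode b d (R.target e))
  nodeLabel := Sum.elim D.nodeLabel (fun v => R.nodeLabel v)
  edgeLabel := Sum.elim D.edgeLabel (fun e => R.edgeLabel e)

/-- The result graph of applying the rule `r` at the match `g`. -/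
noncomputable def Match.result {r : Rule A} {G : Graph A} (g : Match r G) : Graph A :=
  glue r.right g.interface

/-- A direct derivation from `G` to `H` by the rule `r`: a match, together with an
identification of `H` with the result graph (which matters only up to isomorphism). -/
structure DirectDerivation (r : Rule A) (G H : Graph A) where
  mtch : Match r G
  iso : Iso mtch.result H

/-- The track morphism of a direct derivation on nodes: the partial function sending every node
that is not deleted to the corresponding node of the result. -/
noncomputable def DirectDerivation.track {r : Rule A} {G H : Graph A}
    (d : DirectDerivation r G H) : G.V →. H.V :=
  fun v => ⟨v ∈ d.mtch.intermediate.nodes, fun h => d.iso.onV (Sum.inl ⟨v, h⟩)⟩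

/-- `G` directly derives `H` in the system `T`. -/
def DirectlyDerives (T : GTSystem A) (G H : Graph A) : Prop :=
  ∃ r ∈ T.rules, Nonempty (DirectDerivation r G H)

/-- Derivations from `G` to `M` in the system `T`: finitely many (possibly no) direct derivations.
Derivations without steps are isomorphisms. -/
inductive Derivation (T : GTSystem A) : Graph A → Graph A → Type _
  | iso {G M : Graph A} (f : Iso G M) : Derivation T G M
  | step {G H M : Graph A} {r : Rule A} (hr : r ∈ T.rules) (d : DirectDerivation r G H)
      (p : Derivation T H M) : Derivation T G M

/-- The track morphism of a derivation on nodes, as a partial function. -/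
noncomputable def Derivation.track {T : GTSystem A} {G M : Graph A} :
    Derivation T G M → (G.V →. M.V)
  | .iso f => fun v => Part.some (f.onV v)
  | .step _ d p => fun v => (d.track v).bind p.track

/-- `G` derives `M` in zero or more steps. -/
def Derives (T : GTSystem A) (G M : Graph A) : Prop :=
  Nonempty (Derivation T G M)

/-- Two graphs are joinable if they derive a common graph. -/
def Joinable (T : GTSystem A) (H₁ H₂ : Graph A) : Prop :=
  ∃ M, Derives T H₁ M ∧ Derives T H₂ M

/-- `T` is locally confluent on `D`: one-step divergences from graphs in `D` are joinable. -/
def LocallyConfluentOn (T : GTSystem A) (D : Set (AbstractGraph A)) : Prop :=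
  ∀ G H₁ H₂ : Graph A, G.cls ∈ D → DirectlyDerives T G H₁ → DirectlyDerives T G H₂ →
    Joinable T H₁ H₂

section Pairs

variable {r₁ r₂ : Rule A} {G H₁ H₂ : Graph A}

/-- Parallel independence: `g₁(L₁) ∩ g₂(L₂) ⊆ g₁(K₁) ∩ g₂(K₂)`, on nodes and on edges. -/
def ParallelIndependent (d₁ : DirectDerivation r₁ G H₁) (d₂ : DirectDerivation r₂ G H₂) : Prop :=
  (Set.range d₁.mtch.hom.onV ∩ Set.range d₂.mtch.hom.onV ⊆
    Set.range (d₁.mtch.hom.onV ∘ r₁.left.onV) ∩ Set.range (d₂.mtch.hom.onV ∘ r₂.left.onV)) ∧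
  (Set.range d₁.mtch.hom.onE ∩ Set.range d₂.mtch.hom.onE ⊆
    Set.range (d₁.mtch.hom.onE ∘ r₁.left.onE) ∩ Set.range (d₂.mtch.hom.onE ∘ r₂.left.onE))

/-- Critical pairs: the start graph is `g₁(L₁) ∪ g₂(L₂)`, the steps are not parallelly independent,
and they do not have both the same rule and the same match. -/
structure IsCriticalPair (d₁ : DirectDerivation r₁ G H₁) (d₂ : DirectDerivation r₂ G H₂) :
    Prop where
  nodes_cover : Set.range d₁.mtch.hom.onV ∪ Set.range d₂.mtch.hom.onV = Set.univ
  edges_cover : Set.range d₁.mtch.hom.onE ∪ Set.range d₂.mtch.hom.onE = Set.univ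
  not_parallelIndependent : ¬ ParallelIndependent d₁ d₂
  ne_of_rule_eq : r₁ = r₂ → ¬ HEq d₁.mtch.hom d₂.mtch.hom

/-- The persistent nodes: those whose track is defined in both steps. -/
def persistentNodes (d₁ : DirectDerivation r₁ G H₁) (d₂ : DirectDerivation r₂ G H₂) : Set G.V :=
  {v | (d₁.track v).Dom ∧ (d₂.track v).Dom}

/-- Strong joinability: the two results have derivations to a common graph under which the
tracks of every persistent node are defined and equal. -/
def StronglyJoinable (T : GTSystem A) (d₁ : DirectDerivation r₁ G H₁)
    (d₂ : DirectDerivation r₂ G H₂) : Prop :=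
  ∃ (M : Graph A) (p₁ : Derivation T H₁ M) (p₂ : Derivation T H₂ M),
    ∀ v ∈ persistentNodes d₁ d₂,
      ∃ w, w ∈ (d₁.track v).bind p₁.track ∧ w ∈ (d₂.track v).bind p₂.track

/-- A critical pair is non-garbage with respect to `D` if its start graph belongs to the subgraph
closure of `D`. -/
def IsNonGarbageCriticalPair (D : Set (AbstractGraph A)) (d₁ : DirectDerivation r₁ G H₁)
    (d₂ : DirectDerivation r₂ G H₂) : Prop :=
  IsCriticalPair d₁ d₂ ∧ G.cls ∈ subgraphClosure D

end Pairs

end GraphTransformation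

/-! Parallelly independent steps commute, and two steps with the same rule and match have isomorphic
results. Otherwise let S = g₁(L₁) ∪ g₂(L₂) inside G. Both matches restrict to S, the restricted
steps form a critical pair, and it is non-garbage because S ⊆ G. Hence it is strongly joinable, with
some common graph M.

The rest of G meets S only in nodes deleted by neither step: the dangling condition forbids an
uncovered edge at a deleted node. So G is S glued with a context C along a discrete graph B of
persistent nodes (`Match.isGluing_union_context`). Strong joinability says that the nodes of B
survive both derivations and arrive at the same nodes of M. Each derivation can therefore be
replayed with C attached (`Derivation.derives_glue`), and both end in M glued with C along B.

The tool is the reading of a step as a double pushout. Pasting of gluings gives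
`DirectDerivation.exists_extend`: a step extends to any context attached to preserved items only.
The same lemma yields commutation of independent steps, with L₂ and R₂ as contexts attached along
K₂. -/

namespace GraphTransformation

open Function

/-! ### Pushouts of sets along injections, given elementwise -/

section Amalgam

variable {K R D X : Type*}

/-- `X` is the amalgam of `D` and `R` along `K`: it consists of an injective copy of `D` and of a
disjoint injective copy of `R \ b(K)`, and `K` is identified via `d`. -/
structure IsAmalgam (b : K → R) (d : K → D) (u : D → X) (w : R → X) : Prop where
  comm : ∀ k, u (d k) = w (b k)
  inl_injective : Injective u
  inr_injOn : Set.InjOn w (Set.range b)ᶜ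
  cover : ∀ x, (∃ y, u y = x) ∨ ∃ z, z ∉ Set.range b ∧ w z = x
  disjoint : ∀ y z, z ∉ Set.range b → u y ≠ w z

open Classical in
/-- The map of `R` to its amalgam with `D` along `K`. -/
noncomputable def toAmalgam (b : K → R) (d : K → D) (z : R) : D ⊕ {z : R // z ∉ Set.range b} :=
  if h : z ∈ Set.range b then Sum.inl (d h.choose) else Sum.inr ⟨z, h⟩

/-- Injectivity of `b` makes the chosen preimage the only one. -/
theorem toAmalgam_apply {b : K → R} (hb : Injective b) (d : K → D) (k : K) :
    toAmalgam b d (b k) = Sum.inl (d k) := by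
  have h : b k ∈ Set.range b := ⟨k, rfl⟩
  rw [toAmalgam, dif_pos h, hb h.choose_spec]

theorem toAmalgam_of_notMem {b : K → R} (d : K → D) {z : R} (hz : z ∉ Set.range b) :
    toAmalgam b d z = Sum.inr ⟨z, hz⟩ := dif_neg hz

/-- Here `b` need not be injective: commutation makes the choice of preimage irrelevant after
mapping to `X`. -/
theorem elim_toAmalgam {b : K → R} {d : K → D} {u : D → X} {w : R → X}
    (h : ∀ k, u (d k) = w (b k)) (z : R) :
    Sum.elim u (fun z : {z : R // z ∉ Set.range b} => w z) (toAmalgam b d z) = w z := by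
  by_cases hz : z ∈ Set.range b
  · rw [toAmalgam, dif_pos hz, Sum.elim_inl, h, hz.choose_spec]
  · rw [toAmalgam_of_notMem d hz, Sum.elim_inr]

theorem isAmalgam_inl {b : K → R} (hb : Injective b) (d : K → D) :
    IsAmalgam b d Sum.inl (toAmalgam b d) where
  comm k := (toAmalgam_apply hb d k).symm
  inl_injective := Sum.inl_injective
  inr_injOn y hy z hz h := by
    rw [toAmalgam_of_notMem d hy, toAmalgam_of_notMem d hz] at h
    exact congrArg Subtype.val (Sum.inr_injective h)
  cover x := by
    rcases x with x | x
    · exact Or.inl ⟨x, rfl⟩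
    · exact Or.inr ⟨x, x.2, toAmalgam_of_notMem d x.2⟩
  disjoint y z hz := by
    rw [toAmalgam_of_notMem d hz]
    exact Sum.inl_ne_inr

namespace IsAmalgam

variable {b : K → R} {d : K → D} {u : D → X} {w : R → X}

/-- The source of uniqueness of gluings: every amalgam is compared with the standard one on the
disjoint sum. -/
theorem bijective (h : IsAmalgam b d u w) :
    Bijective (Sum.elim u (fun z : {z : R // z ∉ Set.range b} => w z)) := by
  refine ⟨?_, fun x => ?_⟩
  · rintro (y | y) (z | z) hyz
    · exact congrArg _ (h.inl_injective hyz)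
    · exact absurd hyz (h.disjoint _ _ z.2)
    · exact absurd hyz.symm (h.disjoint _ _ y.2)
    · exact congrArg _ (Subtype.ext (h.inr_injOn y.2 z.2 hyz))
  · rcases h.cover x with ⟨y, rfl⟩ | ⟨z, hz, rfl⟩
    · exact ⟨Sum.inl y, rfl⟩
    · exact ⟨Sum.inr ⟨z, hz⟩, rfl⟩

/-- On the image of `b` the map `w` is `u` after `d`; elsewhere its values avoid the image of `u`.
This makes comatches usable as matches. -/
theorem inr_injective (h : IsAmalgam b d u w) (hd : Injective d) : Injective w := by
  intro y z hyz
  by_cases hy : y ∈ Set.range b <;> by_cases hz : z ∈ Set.range b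
  · obtain ⟨k, rfl⟩ := hy
    obtain ⟨l, rfl⟩ := hz
    rw [← h.comm, ← h.comm] at hyz
    rw [hd (h.inl_injective hyz)]
  · obtain ⟨k, rfl⟩ := hy
    exact absurd ((h.comm k).trans hyz) (h.disjoint _ _ hz)
  · obtain ⟨k, rfl⟩ := hz
    exact absurd ((h.comm k).trans hyz.symm) (h.disjoint _ _ hy)
  · exact h.inr_injOn hy hz hyz

/-- Amalgams are stable under bijections of the ambient set. -/
theorem comp_equiv {Y : Type*} (h : IsAmalgam b d u w) (f : X ≃ Y) :
    IsAmalgam b d (f ∘ u) (f ∘ w) where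
  comm k := congrArg f (h.comm k)
  inl_injective := f.injective.comp h.inl_injective
  inr_injOn := f.injective.comp_injOn h.inr_injOn
  cover x := by
    rcases h.cover (f.symm x) with ⟨y, hy⟩ | ⟨z, hz, hy⟩
    · exact Or.inl ⟨y, by simp [hy]⟩
    · exact Or.inr ⟨z, hz, by simp [hy]⟩
  disjoint y z hz := f.injective.ne (h.disjoint y z hz)

/-- Amalgams are stable under bijections of the left component. -/
theorem equiv_left {D' : Type*} (h : IsAmalgam b d u w) (f : D' ≃ D) {d' : K → D'}
    (hd : ∀ k, f (d' k) = d k) : IsAmalgam b d' (u ∘ f) w where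
  comm k := (congrArg u (hd k)).trans (h.comm k)
  inl_injective := h.inl_injective.comp f.injective
  inr_injOn := h.inr_injOn
  cover x := by
    rcases h.cover x with ⟨y, hy⟩ | h
    · exact Or.inl ⟨f.symm y, by simp [hy]⟩
    · exact Or.inr h
  disjoint y z hz := h.disjoint _ z hz

/-- Pasting of amalgams. -/
theorem paste {B C S : Type*} {u : D → S} {g : R → S} (h : IsAmalgam b d u g)
    {β : B → C} {d₀ : B → D} {s : S → X} {c : C → X} (h' : IsAmalgam β (u ∘ d₀) s c) :
    IsAmalgam b (Sum.inl ∘ d)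
      (Sum.elim (s ∘ u) (fun z : {z : C // z ∉ Set.range β} => c z)) (s ∘ g) where
  comm k := congrArg s (h.comm k)
  inl_injective := by
    rintro (y | y) (z | z) hyz
    · exact congrArg _ (h.inl_injective (h'.inl_injective hyz))
    · exact absurd hyz (h'.disjoint _ _ z.2)
    · exact absurd hyz.symm (h'.disjoint _ _ y.2)
    · exact congrArg _ (Subtype.ext (h'.inr_injOn y.2 z.2 hyz))
  inr_injOn := h'.inl_injective.comp_injOn h.inr_injOn
  cover x := by
    rcases h'.cover x with ⟨y, rfl⟩ | ⟨z, hz, rfl⟩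
    · rcases h.cover y with ⟨y, rfl⟩ | ⟨z, hz, rfl⟩
      · exact Or.inl ⟨Sum.inl y, rfl⟩
      · exact Or.inr ⟨z, hz, rfl⟩
    · exact Or.inl ⟨Sum.inr ⟨z, hz⟩, rfl⟩
  disjoint y z hz := by
    rcases y with y | y
    · exact h'.inl_injective.ne (h.disjoint y z hz)
    · exact (h'.disjoint _ _ y.2).symm

end IsAmalgam

end Amalgam

/-! ### Composition of morphisms, inclusions and lifts -/

variable {A : LabelAlphabet}

/-- Composition of morphisms. -/
def Hom.comp {G H M : Graph A} (g : Hom H M) (f : Hom G H) : Hom G M where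
  onV := g.onV ∘ f.onV
  onE := g.onE ∘ f.onE
  source_onE e := by simp [g.source_onE, f.source_onE]
  target_onE e := by simp [g.target_onE, f.target_onE]
  nodeLabel_onV v := by simp [g.nodeLabel_onV, f.nodeLabel_onV]
  edgeLabel_onE e := by simp [g.edgeLabel_onE, f.edgeLabel_onE]

/-- An isomorphism as a morphism. -/
def Iso.toHom {G H : Graph A} (f : Iso G H) : Hom G H where
  onV := f.onV
  onE := f.onE
  source_onE := f.source_onE
  target_onE := f.target_onE
  nodeLabel_onV := f.nodeLabel_onV
  edgeLabel_onE := f.edgeLabel_onE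

/-- The inclusion of a subgraph. -/
def Subgraph.incl {G : Graph A} (S : Subgraph G) : Hom S.toGraph G where
  onV := Subtype.val
  onE := Subtype.val
  source_onE _ := rfl
  target_onE _ := rfl
  nodeLabel_onV _ := rfl
  edgeLabel_onE _ := rfl

/-- Restriction of a morphism to a subgraph containing its image. -/
def Subgraph.lift {F G : Graph A} (S : Subgraph G) (f : Hom F G) (hV : ∀ v, f.onV v ∈ S.nodes)
    (hE : ∀ e, f.onE e ∈ S.edges) : Hom F S.toGraph where
  onV v := ⟨f.onV v, hV v⟩
  onE e := ⟨f.onE e, hE e⟩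
  source_onE e := Subtype.ext (f.source_onE e)
  target_onE e := Subtype.ext (f.target_onE e)
  nodeLabel_onV := f.nodeLabel_onV
  edgeLabel_onE := f.edgeLabel_onE

theorem Subgraph.lift_injective {F G : Graph A} (S : Subgraph G) {f : Hom F G} (hf : f.Injective)
    (hV : ∀ v, f.onV v ∈ S.nodes) (hE : ∀ e, f.onE e ∈ S.edges) : (S.lift f hV hE).Injective :=
  ⟨fun _ _ h => hf.1 (congrArg Subtype.val h), fun _ _ h => hf.2 (congrArg Subtype.val h)⟩

/-! ### Gluings of graphs: existence, uniqueness, pasting -/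

section Gluing

variable {K R D X : Graph A}

/-- `X` is the gluing of `D` and `R` along `K`. -/
structure IsGluing (b : Hom K R) (d : Hom K D) (u : Hom D X) (w : Hom R X) : Prop where
  nodes : IsAmalgam b.onV d.onV u.onV w.onV
  edges : IsAmalgam b.onE d.onE u.onE w.onE

/-- The inclusion of `D` into the gluing. -/
noncomputable def glueInl (b : Hom K R) (d : Hom K D) : Hom D (glue b d) where
  onV := Sum.inl
  onE := Sum.inl
  source_onE _ := rfl
  target_onE _ := rfl
  nodeLabel_onV _ := rfl
  edgeLabel_onE _ := rfl

/-- The morphism from `R` to the gluing. -/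
noncomputable def glueInr {b : Hom K R} (hb : b.Injective) (d : Hom K D) : Hom R (glue b d) where
  onV := toAmalgam b.onV d.onV
  onE := toAmalgam b.onE d.onE
  source_onE e := by
    by_cases he : e ∈ Set.range b.onE
    · obtain ⟨k, rfl⟩ := he
      rw [toAmalgam_apply hb.2, b.source_onE, toAmalgam_apply hb.1, ← d.source_onE]
      rfl
    · rw [toAmalgam_of_notMem _ he]
      -- On nodes, `glueNode` is the same case distinction as `toAmalgam`.
      rfl
  target_onE e := by
    by_cases he : e ∈ Set.range b.onE
    · obtain ⟨k, rfl⟩ := he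
      rw [toAmalgam_apply hb.2, b.target_onE, toAmalgam_apply hb.1, ← d.target_onE]
      rfl
    · rw [toAmalgam_of_notMem _ he]
      rfl
  nodeLabel_onV v := by
    by_cases hv : v ∈ Set.range b.onV
    · obtain ⟨k, rfl⟩ := hv
      rw [toAmalgam_apply hb.1, b.nodeLabel_onV, ← d.nodeLabel_onV]
      rfl
    · rw [toAmalgam_of_notMem _ hv]
      rfl
  edgeLabel_onE e := by
    by_cases he : e ∈ Set.range b.onE
    · obtain ⟨k, rfl⟩ := he
      rw [toAmalgam_apply hb.2, b.edgeLabel_onE, ← d.edgeLabel_onE]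
      rfl
    · rw [toAmalgam_of_notMem _ he]
      rfl

theorem isGluing_glue {b : Hom K R} (hb : b.Injective) (d : Hom K D) :
    IsGluing b d (glueInl b d) (glueInr hb d) :=
  ⟨isAmalgam_inl hb.1 _, isAmalgam_inl hb.2 _⟩

/-- The morphism out of a gluing induced by a commuting square. -/
noncomputable def glueDesc {b : Hom K R} {d : Hom K D} (u : Hom D X) (w : Hom R X)
    (hV : ∀ k, u.onV (d.onV k) = w.onV (b.onV k)) : Hom (glue b d) X where
  onV := Sum.elim u.onV (fun z : {z : R.V // z ∉ Set.range b.onV} => w.onV z)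
  onE := Sum.elim u.onE (fun z : {z : R.E // z ∉ Set.range b.onE} => w.onE z)
  source_onE e := by
    rcases e with e | e
    · exact u.source_onE e
    · exact (w.source_onE e).trans (elim_toAmalgam hV _).symm
  target_onE e := by
    rcases e with e | e
    · exact u.target_onE e
    · exact (w.target_onE e).trans (elim_toAmalgam hV _).symm
  nodeLabel_onV v := by
    rcases v with v | v
    · exact u.nodeLabel_onV v
    · exact w.nodeLabel_onV v
  edgeLabel_onE e := by
    rcases e with e | e
    · exact u.edgeLabel_onE e
    · exact w.edgeLabel_onE e

namespace IsGluing

variable {b : Hom K R} {d : Hom K D} {u : Hom D X} {w : Hom R X}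

/-- Gluings are unique up to isomorphism. -/
noncomputable def iso (h : IsGluing b d u w) : Iso (glue b d) X where
  onV := Equiv.ofBijective _ h.nodes.bijective
  onE := Equiv.ofBijective _ h.edges.bijective
  source_onE := (glueDesc u w h.nodes.comm).source_onE
  target_onE := (glueDesc u w h.nodes.comm).target_onE
  nodeLabel_onV := (glueDesc u w h.nodes.comm).nodeLabel_onV
  edgeLabel_onE := (glueDesc u w h.nodes.comm).edgeLabel_onE

theorem comp_iso {Y : Graph A} (h : IsGluing b d u w) (f : Iso X Y) :
    IsGluing b d (f.toHom.comp u) (f.toHom.comp w) :=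
  ⟨h.nodes.comp_equiv f.onV, h.edges.comp_equiv f.onE⟩

theorem iso_left {D' : Graph A} (h : IsGluing b d u w) (f : Iso D' D) {d' : Hom K D'}
    (hV : ∀ v, f.onV (d'.onV v) = d.onV v) (hE : ∀ e, f.onE (d'.onE e) = d.onE e) :
    IsGluing b d' (u.comp f.toHom) w :=
  ⟨h.nodes.equiv_left f.onV hV, h.edges.equiv_left f.onE hE⟩

/-- Pasting of gluings. -/
theorem paste {B C S : Graph A} {u : Hom D S} {g : Hom R S} (h : IsGluing b d u g)
    {β : Hom B C} {d₀ : Hom B D} {s : Hom S X} {c : Hom C X}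
    (h' : IsGluing β (u.comp d₀) s c) :
    IsGluing b ((glueInl β d₀).comp d) (glueDesc (s.comp u) c h'.nodes.comm) (s.comp g) :=
  ⟨h.nodes.paste h'.nodes, h.edges.paste h'.edges⟩

end IsGluing

end Gluing

/-! ### Direct derivations as double pushouts -/

section DoublePushout

variable {r : Rule A} {G H D : Graph A}

/-- An edge outside the image of `g` comes from `D`, hence so do its end points, and `D` is disjoint
from the deleted part. -/
theorem IsGluing.dangling {d : Hom r.K D} {u : Hom D G} {g : Hom r.L G}
    (h : IsGluing r.left d u g) : Dangling r g := by
  intro e he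
  rcases h.edges.cover e with ⟨y, rfl⟩ | ⟨z, -, rfl⟩
  · constructor
    · rintro ⟨l, hl, hle⟩
      rw [u.source_onE] at hle
      exact h.nodes.disjoint _ _ hl hle.symm
    · rintro ⟨l, hl, hle⟩
      rw [u.target_onE] at hle
      exact h.nodes.disjoint _ _ hl hle.symm
  · exact absurd ⟨z, rfl⟩ he

/-- The match given by a pushout complement. -/
def IsGluing.toMatch {d : Hom r.K D} {u : Hom D G} {g : Hom r.L G}
    (h : IsGluing r.left d u g) (hg : g.Injective) : Match r G :=
  ⟨g, hg, h.dangling⟩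

/-- The given pushout complement is isomorphic to the intermediate graph of the match. -/
noncomputable def IsGluing.intermediateIso {d : Hom r.K D} {u : Hom D G} {g : Hom r.L G}
    (h : IsGluing r.left d u g) (hg : g.Injective) :
    Iso D (h.toMatch hg).intermediate.toGraph where
  onV := Equiv.ofBijective
    (fun x => ⟨u.onV x, fun ⟨_, hl, hx⟩ => h.nodes.disjoint _ _ hl hx.symm⟩)
    ⟨fun _ _ hxy => h.nodes.inl_injective (congrArg Subtype.val hxy), fun ⟨x, hx⟩ => by
      rcases h.nodes.cover x with ⟨y, rfl⟩ | ⟨z, hz, rfl⟩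
      · exact ⟨y, rfl⟩
      · exact absurd ⟨z, hz, rfl⟩ hx⟩
  onE := Equiv.ofBijective
    (fun x => ⟨u.onE x, fun ⟨_, hl, hx⟩ => h.edges.disjoint _ _ hl hx.symm⟩)
    ⟨fun _ _ hxy => h.edges.inl_injective (congrArg Subtype.val hxy), fun ⟨x, hx⟩ => by
      rcases h.edges.cover x with ⟨y, rfl⟩ | ⟨z, hz, rfl⟩
      · exact ⟨y, rfl⟩
      · exact absurd ⟨z, hz, rfl⟩ hx⟩
  source_onE e := Subtype.ext (u.source_onE e)
  target_onE e := Subtype.ext (u.target_onE e)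
  nodeLabel_onV := u.nodeLabel_onV
  edgeLabel_onE := u.edgeLabel_onE

/-- A double pushout yields a direct derivation. -/
noncomputable def DirectDerivation.ofGluing {d : Hom r.K D} {u : Hom D G} {g : Hom r.L G}
    (h : IsGluing r.left d u g) (hg : g.Injective) {u' : Hom D H} {g' : Hom r.R H}
    (h' : IsGluing r.right d u' g') : DirectDerivation r G H where
  mtch := h.toMatch hg
  -- The right square is transported from `D` to the intermediate graph of the match; uniqueness of
  -- gluings then identifies the result with `H`.
  iso := (h'.iso_left (d' := (h.toMatch hg).interface) (h.intermediateIso hg).symm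
    (fun v => ((h.intermediateIso hg).onV.symm_apply_eq).2
      (Subtype.ext (h.nodes.comm v).symm))
    (fun e => ((h.intermediateIso hg).onE.symm_apply_eq).2
      (Subtype.ext (h.edges.comm e).symm))).iso

theorem Match.isGluing (m : Match r G) :
    IsGluing r.left m.interface m.intermediate.incl m.hom where
  nodes :=
    { comm := fun _ => rfl
      inl_injective := Subtype.val_injective
      inr_injOn := m.injective.1.injOn
      cover := fun x => by
        by_cases hx : x ∈ deletedNodes r m.hom
        · exact Or.inr hx
        · exact Or.inl ⟨⟨x, hx⟩, rfl⟩
      disjoint := fun y z hz h => y.2 ⟨z, hz, h.symm⟩ }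
  edges :=
    { comm := fun _ => rfl
      inl_injective := Subtype.val_injective
      inr_injOn := m.injective.2.injOn
      cover := fun x => by
        by_cases hx : x ∈ deletedEdges r m.hom
        · exact Or.inr hx
        · exact Or.inl ⟨⟨x, hx⟩, rfl⟩
      disjoint := fun y z hz h => y.2 ⟨z, hz, h.symm⟩ }

/-- The morphism from the intermediate graph to the result of a direct derivation. -/
noncomputable def DirectDerivation.inl (d : DirectDerivation r G H) :
    Hom d.mtch.intermediate.toGraph H :=
  d.iso.toHom.comp (glueInl _ _)

/-- The comatch of a direct derivation. -/
noncomputable def DirectDerivation.inr (d : DirectDerivation r G H) : Hom r.R H :=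
  d.iso.toHom.comp (glueInr r.right_injective _)

theorem DirectDerivation.isGluing (d : DirectDerivation r G H) :
    IsGluing r.right d.mtch.interface d.inl d.inr :=
  (isGluing_glue r.right_injective _).comp_iso d.iso

/-- The result of a direct derivation is determined by the match up to isomorphism. -/
theorem DirectDerivation.nonempty_iso {H' : Graph A} (d : DirectDerivation r G H)
    (d' : DirectDerivation r G H') (h : d.mtch.hom = d'.mtch.hom) : Nonempty (Iso H H') := by
  obtain ⟨⟨g, hg, hd⟩, f⟩ := d
  obtain ⟨⟨g', hg', hd'⟩, f'⟩ := d'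
  -- The matches now differ only in proofs, so both results are the same graph.
  obtain rfl : g = g' := h
  exact ⟨f.symm.trans f'⟩

variable {B C X : Graph A}

/-- Since `B` maps into the intermediate graph, `C` can be glued to that graph as well; pasting on
both sides gives a double pushout from `X` to `H` with `C` attached. -/
theorem DirectDerivation.exists_extend (d : DirectDerivation r G H) {β : Hom B C}
    (hβ : β.Injective) (d₀ : Hom B d.mtch.intermediate.toGraph) {s : Hom G X} {c : Hom C X}
    (h : IsGluing β (d.mtch.intermediate.incl.comp d₀) s c) :
    ∃ d' : DirectDerivation r X (glue β (d.inl.comp d₀)),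
      d'.mtch.hom = s.comp d.mtch.hom :=
  ⟨.ofGluing (d.mtch.isGluing.paste h)
    ⟨h.nodes.inl_injective.comp d.mtch.injective.1, h.edges.inl_injective.comp d.mtch.injective.2⟩
    (d.isGluing.paste (isGluing_glue hβ _)), rfl⟩

end DoublePushout

/-! ### Derivations, tracks and embedding into a context -/

theorem joinable_of_iso (T : GTSystem A) {H₁ H₂ : Graph A} (f : Iso H₁ H₂) : Joinable T H₁ H₂ :=
  ⟨H₂, ⟨.iso f⟩, ⟨.iso (Iso.refl _)⟩⟩

theorem DirectDerivation.derives {T : GTSystem A} {r : Rule A} (hr : r ∈ T.rules) {G H : Graph A}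
    (d : DirectDerivation r G H) : Derives T G H :=
  ⟨.step hr d (.iso (Iso.refl _))⟩

/-- Needed to turn the tracks of the boundary nodes into a graph morphism. -/
theorem Derivation.nodeLabel_of_mem_track {T : GTSystem A} {S M : Graph A} (p : Derivation T S M)
    {v : S.V} {w : M.V} (h : w ∈ p.track v) : M.nodeLabel w = S.nodeLabel v := by
  induction p with
  | iso f =>
    rw [Part.mem_some_iff.1 h]
    exact f.nodeLabel_onV v
  | step hr d p ih =>
    obtain ⟨_, ⟨hv, rfl⟩, hw⟩ := Part.mem_bind_iff.1 h
    exact (ih hw).trans (d.inl.nodeLabel_onV ⟨v, hv⟩)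

/-- Embedding of a derivation into a context that is attached to preserved nodes only. -/
theorem Derivation.derives_glue {T : GTSystem A} {S M : Graph A} (p : Derivation T S M)
    {B C : Graph A} [IsEmpty B.E] {β : Hom B C} (hβ : β.Injective) {δ : Hom B S} {δ' : Hom B M}
    (hδ : ∀ v, δ'.onV v ∈ p.track (δ.onV v)) {X : Graph A} {s : Hom S X} {c : Hom C X}
    (h : IsGluing β δ s c) : Derives T X (glue β δ') := by
  induction p generalizing X with
  | iso f =>
    refine ⟨.iso (h.iso_left f.symm (d' := δ') (fun v => ?_) isEmptyElim).iso.symm⟩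
    rw [Part.mem_some_iff.1 (hδ v)]
    exact f.onV.symm_apply_apply _
  | @step S S' M r hr d p ih =>
    -- A defined track means that the first step preserves the node and the remaining derivation
    -- tracks its image.
    have hmem : ∀ v, ∃ hv : δ.onV v ∈ d.mtch.intermediate.nodes,
        δ'.onV v ∈ p.track (d.inl.onV ⟨δ.onV v, hv⟩) := by
      intro v
      obtain ⟨_, ⟨hv, rfl⟩, hw⟩ := Part.mem_bind_iff.1 (hδ v)
      exact ⟨hv, hw⟩
    choose hn ht using hmem
    let d₀ : Hom B d.mtch.intermediate.toGraph := d.mtch.intermediate.lift δ hn isEmptyElim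
    obtain ⟨d', -⟩ := d.exists_extend hβ d₀ (s := s) (c := c) h
    obtain ⟨q⟩ := ih (δ := d.inl.comp d₀) ht (isGluing_glue hβ _)
    exact ⟨.step hr d' q⟩

/-! ### Independent steps, and the context of a pair of steps -/

section Pairs

variable {r₁ r₂ : Rule A} {G H₁ H₂ : Graph A}

/-- Restriction of a match to a subgraph containing its image. -/
def Match.restrict {r : Rule A} (m : Match r G) (S : Subgraph G)
    (hV : ∀ v, m.hom.onV v ∈ S.nodes) (hE : ∀ e, m.hom.onE e ∈ S.edges) :
    Match r S.toGraph where
  hom := S.lift m.hom hV hE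
  injective := S.lift_injective m.injective hV hE
  dangling e he := by
    have h := m.dangling e.1 (fun ⟨l, hl⟩ => he ⟨l, Subtype.ext hl⟩)
    exact ⟨fun ⟨l, hl, hx⟩ => h.1 ⟨l, hl, congrArg Subtype.val hx⟩,
      fun ⟨l, hl, hx⟩ => h.2 ⟨l, hl, congrArg Subtype.val hx⟩⟩

/-- The local Church-Rosser property: parallelly independent steps commute. -/
theorem ParallelIndependent.joinable {T : GTSystem A} (hr₁ : r₁ ∈ T.rules) (hr₂ : r₂ ∈ T.rules)
    {d₁ : DirectDerivation r₁ G H₁} {d₂ : DirectDerivation r₂ G H₂}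
    (h : ParallelIndependent d₁ d₂) : Joinable T H₁ H₂ := by
  -- By independence the second step deletes nothing in the image of the first match, so `r₁`
  -- applies already to the intermediate graph of `d₂`. Call the result N.
  let m : Match r₁ d₂.mtch.intermediate.toGraph := d₁.mtch.restrict _
    (fun v => by
      rintro ⟨l, hl, hlv⟩
      obtain ⟨-, k, hk⟩ := h.1 ⟨⟨v, rfl⟩, ⟨l, hlv⟩⟩
      exact hl ⟨k, d₂.mtch.injective.1 (hk.trans hlv.symm)⟩)
    (fun v => by
      rintro ⟨l, hl, hlv⟩
      obtain ⟨-, k, hk⟩ := h.2 ⟨⟨v, rfl⟩, ⟨l, hlv⟩⟩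
      exact hl ⟨k, d₂.mtch.injective.2 (hk.trans hlv.symm)⟩)
  let d : DirectDerivation r₁ d₂.mtch.intermediate.toGraph m.result := ⟨m, Iso.refl _⟩
  let d₀ : Hom r₂.K d.mtch.intermediate.toGraph :=
    d.mtch.intermediate.lift d₂.mtch.interface
      (fun v => by
        rintro ⟨l, hl, hlv⟩
        obtain ⟨⟨k, hk⟩, -⟩ := h.1 ⟨⟨l, rfl⟩, ⟨_, (congrArg Subtype.val hlv).symm⟩⟩
        exact hl ⟨k, d₁.mtch.injective.1 hk⟩)
      (fun v => by
        rintro ⟨l, hl, hlv⟩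
        obtain ⟨⟨k, hk⟩, -⟩ := h.2 ⟨⟨l, rfl⟩, ⟨_, (congrArg Subtype.val hlv).symm⟩⟩
        exact hl ⟨k, d₁.mtch.injective.2 hk⟩)
  have hd₀ : d₀.Injective := Subgraph.lift_injective _
    (Subgraph.lift_injective _ (f := d₂.mtch.hom.comp r₂.left)
      ⟨d₂.mtch.injective.1.comp r₂.left_injective.1,
        d₂.mtch.injective.2.comp r₂.left_injective.2⟩ _ _) _ _
  -- Attaching L₂ along K₂ recovers `d₁`, so `H₁` is N glued with L₂; attaching R₂ instead gives a
  -- step by `r₁` from `H₂` to N glued with R₂. Replacing L₂ by R₂ is a step by `r₂` from `H₁` to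
  -- the same graph.
  obtain ⟨e₁, he₁⟩ := d.exists_extend r₂.left_injective d₀ d₂.mtch.isGluing
  obtain ⟨e₂, -⟩ := d.exists_extend r₂.right_injective d₀ d₂.isGluing
  obtain ⟨f⟩ := e₁.nonempty_iso d₁ he₁
  have hL := (isGluing_glue r₂.left_injective (d.inl.comp d₀)).comp_iso f
  refine ⟨_, (DirectDerivation.ofGluing hL ⟨?_, ?_⟩
    (isGluing_glue r₂.right_injective (d.inl.comp d₀))).derives hr₂, e₂.derives hr₁⟩
  · exact hL.nodes.inr_injective (d.isGluing.nodes.inl_injective.comp hd₀.1)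
  · exact hL.edges.inr_injective (d.isGluing.edges.inl_injective.comp hd₀.2)

/-- The subgraph covered by two matches. -/
def Match.union (m₁ : Match r₁ G) (m₂ : Match r₂ G) : Subgraph G where
  nodes := Set.range m₁.hom.onV ∪ Set.range m₂.hom.onV
  edges := Set.range m₁.hom.onE ∪ Set.range m₂.hom.onE
  source_mem := by
    rintro _ (⟨e, rfl⟩ | ⟨e, rfl⟩)
    · exact Or.inl ⟨_, (m₁.hom.source_onE e).symm⟩
    · exact Or.inr ⟨_, (m₂.hom.source_onE e).symm⟩
  target_mem := by
    rintro _ (⟨e, rfl⟩ | ⟨e, rfl⟩)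
    · exact Or.inl ⟨_, (m₁.hom.target_onE e).symm⟩
    · exact Or.inr ⟨_, (m₂.hom.target_onE e).symm⟩

/-- The context of two matches: the edges not covered by them, and all persistent nodes. -/
def Match.context (m₁ : Match r₁ G) (m₂ : Match r₂ G) : Subgraph G where
  nodes := (deletedNodes r₁ m₁.hom)ᶜ ∩ (deletedNodes r₂ m₂.hom)ᶜ
  edges := (Set.range m₁.hom.onE ∪ Set.range m₂.hom.onE)ᶜ
  source_mem e he := ⟨(m₁.dangling e fun h => he (Or.inl h)).1,
    (m₂.dangling e fun h => he (Or.inr h)).1⟩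
  target_mem e he := ⟨(m₁.dangling e fun h => he (Or.inl h)).2,
    (m₂.dangling e fun h => he (Or.inr h)).2⟩

/-- The discrete graph of the covered persistent nodes. -/
def Match.boundary (m₁ : Match r₁ G) (m₂ : Match r₂ G) : Subgraph G where
  nodes := (m₁.union m₂).nodes ∩ (m₁.context m₂).nodes
  edges := ∅
  source_mem _ h := h.elim
  target_mem _ h := h.elim

instance (m₁ : Match r₁ G) (m₂ : Match r₂ G) : IsEmpty (m₁.boundary m₂).toGraph.E :=
  inferInstanceAs (IsEmpty (∅ : Set G.E))

/-- The inclusion of the boundary in the covered subgraph. -/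
def Match.boundaryUnion (m₁ : Match r₁ G) (m₂ : Match r₂ G) :
    Hom (m₁.boundary m₂).toGraph (m₁.union m₂).toGraph :=
  (m₁.union m₂).lift (m₁.boundary m₂).incl (fun v => v.2.1) isEmptyElim

/-- The inclusion of the boundary in the context. -/
def Match.boundaryContext (m₁ : Match r₁ G) (m₂ : Match r₂ G) :
    Hom (m₁.boundary m₂).toGraph (m₁.context m₂).toGraph :=
  (m₁.context m₂).lift (m₁.boundary m₂).incl (fun v => v.2.2) isEmptyElim

theorem Match.boundaryContext_injective (m₁ : Match r₁ G) (m₂ : Match r₂ G) :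
    (m₁.boundaryContext m₂).Injective :=
  Subgraph.lift_injective _ ⟨Subtype.val_injective, Subtype.val_injective⟩ _ _

theorem Match.deletedNodes_subset_range {r : Rule A} (m : Match r G) :
    deletedNodes r m.hom ⊆ Set.range m.hom.onV := Set.image_subset_range _ _

/-- A graph is the gluing of the covered subgraph and the context of two matches. -/
theorem Match.isGluing_union_context (m₁ : Match r₁ G) (m₂ : Match r₂ G) :
    IsGluing (m₁.boundaryContext m₂) (m₁.boundaryUnion m₂) (m₁.union m₂).incl
      (m₁.context m₂).incl where
  nodes :=
    { comm := fun _ => rfl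
      inl_injective := Subtype.val_injective
      inr_injOn := Subtype.val_injective.injOn
      cover := fun x => by
        by_cases hx : x ∈ (m₁.union m₂).nodes
        · exact Or.inl ⟨⟨x, hx⟩, rfl⟩
        -- Deleted nodes are covered, so an uncovered node lies in the context.
        · refine Or.inr ⟨⟨x, fun h => hx (Or.inl (m₁.deletedNodes_subset_range h)),
            fun h => hx (Or.inr (m₂.deletedNodes_subset_range h))⟩, ?_, rfl⟩
          rintro ⟨y, hy⟩
          exact hx ((show y.1 = x from congrArg Subtype.val hy) ▸ y.2.1)
      disjoint := fun y z hz h => hz ⟨⟨z.1, (show y.1 = z.1 from h) ▸ y.2, z.2⟩, rfl⟩ }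
  edges :=
    { comm := isEmptyElim
      inl_injective := Subtype.val_injective
      inr_injOn := Subtype.val_injective.injOn
      cover := fun x => by
        by_cases hx : x ∈ (m₁.union m₂).edges
        · exact Or.inl ⟨⟨x, hx⟩, rfl⟩
        · exact Or.inr ⟨⟨x, hx⟩, fun ⟨y, _⟩ => isEmptyElim y, rfl⟩
      disjoint := fun y z _ h => z.2 ((show y.1 = z.1 from h) ▸ y.2) }

/-- Extension of a strongly joinable pair on the covered subgraph to the whole graph. -/
theorem joinable_of_stronglyJoinable_restrict {T : GTSystem A} (d₁ : DirectDerivation r₁ G H₁)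
    (d₂ : DirectDerivation r₂ G H₂) {S₁ S₂ : Graph A}
    (e₁ : DirectDerivation r₁ (d₁.mtch.union d₂.mtch).toGraph S₁)
    (e₂ : DirectDerivation r₂ (d₁.mtch.union d₂.mtch).toGraph S₂)
    (h₁ : (d₁.mtch.union d₂.mtch).incl.comp e₁.mtch.hom = d₁.mtch.hom)
    (h₂ : (d₁.mtch.union d₂.mtch).incl.comp e₂.mtch.hom = d₂.mtch.hom)
    (h : StronglyJoinable T e₁ e₂) : Joinable T H₁ H₂ := by
  obtain ⟨M, p₁, p₂, hp⟩ := h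
  let m₁ := d₁.mtch
  let m₂ := d₂.mtch
  let δ := m₁.boundaryUnion m₂
  have hβ := m₁.boundaryContext_injective m₂
  have hn₁ : ∀ v, δ.onV v ∈ e₁.mtch.intermediate.nodes := by
    rintro v ⟨l, hl, hlv⟩
    exact v.2.2.1 ⟨l, hl, by rw [← h₁]; exact congrArg Subtype.val hlv⟩
  have hn₂ : ∀ v, δ.onV v ∈ e₂.mtch.intermediate.nodes := by
    rintro v ⟨l, hl, hlv⟩
    exact v.2.2.2 ⟨l, hl, by rw [← h₂]; exact congrArg Subtype.val hlv⟩
  let δ₁ := e₁.mtch.intermediate.lift δ hn₁ isEmptyElim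
  let δ₂ := e₂.mtch.intermediate.lift δ hn₂ isEmptyElim
  have hw : ∀ v, ∃ w, w ∈ p₁.track (e₁.inl.onV (δ₁.onV v)) ∧
      w ∈ p₂.track (e₂.inl.onV (δ₂.onV v)) := by
    intro v
    obtain ⟨w, hw₁, hw₂⟩ := hp (δ.onV v) ⟨hn₁ v, hn₂ v⟩
    obtain ⟨_, ⟨_, rfl⟩, hw₁⟩ := Part.mem_bind_iff.1 hw₁
    obtain ⟨_, ⟨_, rfl⟩, hw₂⟩ := Part.mem_bind_iff.1 hw₂
    exact ⟨w, hw₁, hw₂⟩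
  choose w hw₁ hw₂ using hw
  -- A single morphism serves both derivations because the tracks agree; discreteness of the
  -- boundary leaves only node labels to check.
  let ω : Hom (m₁.boundary m₂).toGraph M :=
    { onV := w
      onE := isEmptyElim
      source_onE := isEmptyElim
      target_onE := isEmptyElim
      nodeLabel_onV := fun v => (p₁.nodeLabel_of_mem_track (hw₁ v)).trans
        ((e₁.inl.comp δ₁).nodeLabel_onV v)
      edgeLabel_onE := isEmptyElim }
  have hG := m₁.isGluing_union_context m₂
  -- `iso_left` along the identity only replaces the boundary inclusion by its factorization through
  -- the intermediate graph.
  obtain ⟨c₁, hc₁⟩ := e₁.exists_extend hβ δ₁ (hG.iso_left (Iso.refl _) (fun _ => rfl) isEmptyElim)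
  obtain ⟨c₂, hc₂⟩ := e₂.exists_extend hβ δ₂ (hG.iso_left (Iso.refl _) (fun _ => rfl) isEmptyElim)
  obtain ⟨f₁⟩ := c₁.nonempty_iso d₁ (hc₁.trans h₁)
  obtain ⟨f₂⟩ := c₂.nonempty_iso d₂ (hc₂.trans h₂)
  exact ⟨glue (m₁.boundaryContext m₂) ω,
    p₁.derives_glue hβ hw₁ ((isGluing_glue hβ _).comp_iso f₁),
    p₂.derives_glue hβ hw₂ ((isGluing_glue hβ _).comp_iso f₂)⟩

end Pairs

theorem toGraph_cls_mem_subgraphClosure {D : Set (AbstractGraph A)} {G : Graph A}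
    (hG : G.cls ∈ D) (S : Subgraph G) : S.toGraph.cls ∈ subgraphClosure D :=
  Set.mem_sInter.2 fun _ hD => hD.2 G S (hD.1 hG)

end GraphTransformation

/-! ### Local confluence -/

theorem mainTheorem4 {A : GraphTransformation.LabelAlphabet}
    (T : GraphTransformation.GTSystem A) (D : Set (GraphTransformation.AbstractGraph A))
    (h : ∀ (r₁ r₂ : GraphTransformation.Rule A) (G H₁ H₂ : GraphTransformation.Graph A)
      (d₁ : GraphTransformation.DirectDerivation r₁ G H₁)
      (d₂ : GraphTransformation.DirectDerivation r₂ G H₂),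
      r₁ ∈ T.rules → r₂ ∈ T.rules →
      GraphTransformation.IsNonGarbageCriticalPair D d₁ d₂ →
      GraphTransformation.StronglyJoinable T d₁ d₂) :
    GraphTransformation.LocallyConfluentOn T D := by
  rintro G H₁ H₂ hG ⟨r₁, hr₁, ⟨d₁⟩⟩ ⟨r₂, hr₂, ⟨d₂⟩⟩
  by_cases hI : GraphTransformation.ParallelIndependent d₁ d₂
  · exact hI.joinable hr₁ hr₂
  by_cases hS : r₁ = r₂ ∧ HEq d₁.mtch.hom d₂.mtch.hom
  · obtain ⟨rfl, hhom⟩ := hS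
    obtain ⟨f⟩ := d₁.nonempty_iso d₂ (eq_of_heq hhom)
    exact GraphTransformation.joinable_of_iso T f
  let S := d₁.mtch.union d₂.mtch
  let m₁ := d₁.mtch.restrict S (fun v => Or.inl ⟨v, rfl⟩) (fun e => Or.inl ⟨e, rfl⟩)
  let m₂ := d₂.mtch.restrict S (fun v => Or.inr ⟨v, rfl⟩) (fun e => Or.inr ⟨e, rfl⟩)
  let e₁ : GraphTransformation.DirectDerivation r₁ S.toGraph m₁.result :=
    ⟨m₁, GraphTransformation.Iso.refl _⟩
  let e₂ : GraphTransformation.DirectDerivation r₂ S.toGraph m₂.result :=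
    ⟨m₂, GraphTransformation.Iso.refl _⟩
  refine GraphTransformation.joinable_of_stronglyJoinable_restrict d₁ d₂ e₁ e₂ rfl rfl
    (h r₁ r₂ _ _ _ e₁ e₂ hr₁ hr₂
      ⟨⟨?_, ?_, ?_, ?_⟩, GraphTransformation.toGraph_cls_mem_subgraphClosure hG S⟩)
  · refine Set.eq_univ_of_forall ?_
    rintro ⟨_, ⟨v, rfl⟩ | ⟨v, rfl⟩⟩
    · exact Or.inl ⟨v, rfl⟩
    · exact Or.inr ⟨v, rfl⟩
  · refine Set.eq_univ_of_forall ?_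
    rintro ⟨_, ⟨e, rfl⟩ | ⟨e, rfl⟩⟩
    · exact Or.inl ⟨e, rfl⟩
    · exact Or.inr ⟨e, rfl⟩
  -- Independence inside `S` would carry over to `G`, as the inclusion of `S` is injective.
  · refine fun hP => hI ⟨?_, ?_⟩
    · rintro _ ⟨⟨v, rfl⟩, ⟨w, hw⟩⟩
      obtain ⟨⟨k, hk⟩, ⟨l, hl⟩⟩ := hP.1 ⟨⟨v, rfl⟩, ⟨w, Subtype.ext hw⟩⟩
      exact ⟨⟨k, congrArg Subtype.val hk⟩, ⟨l, congrArg Subtype.val hl⟩⟩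
    · rintro _ ⟨⟨v, rfl⟩, ⟨w, hw⟩⟩
      obtain ⟨⟨k, hk⟩, ⟨l, hl⟩⟩ := hP.2 ⟨⟨v, rfl⟩, ⟨w, Subtype.ext hw⟩⟩
      exact ⟨⟨k, congrArg Subtype.val hk⟩, ⟨l, congrArg Subtype.val hl⟩⟩
  · rintro rfl hhom
    refine hS ⟨rfl, heq_of_eq ?_⟩
    exact congrArg S.incl.comp (eq_of_heq hhom)
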